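/- Let $p,q\in(1,\infty)$. Let $F_{p,q}(x)=\int_0^x(1-t^q)^{-1/p}\,dt$ for $x\in[0,1]$ and $\pi_{p,q}=2F_{p,q}(1)$. Let $\sin_{p,q}$ be the inverse of $F_{p,q}:[0,1]\to[0,\pi_{p,q}/2]$, extended to $\mathbb{R}$ as a $2\pi_{p,q}$-periodic function by $\sin_{p,q}x=\sin_{p,q}(\pi_{p,q}-x)$ and $\sin_{p,q}(-x)=-\sin_{p,q}x$. For real $m>1$ the function $x\mapsto|\sin_{p,q}(x)/x|^m$ is integrable on $(0,\infty)$; put $$I_{p,q}(m)=m^{1/q}\int_0^\infty\left|\frac{\sin_{p,q}x}{x}\right|^m dx .$$ Then there are real constants $\gamma_0,\gamma_1,\gamma_2,\dots$, independent of $m$, such that, as $m\to\infty$ through the reals, $I_{p,q}$ has the asymptotic expansion (in the sense of Poincaré) $$I_{p,q}(m)\sim\frac1q\sum_{j=0}^\infty\Gamma\left(j+\frac1q\right)\frac{\gamma_j}{m^j},$$ that is, for every integer $N\ge0$, $$I_{p,q}(m)=\frac1q\sum_{j=0}^{N-1}\Gamma\left(j+\frac1q\right)\frac{\gamma_j}{m^j}+O\left(m^{-N}\right)\qquad(m\to\infty).$$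 Moreover, the sum of the first two terms ($j=0,1$) of the expansion is $$\frac1q\,\Gamma\left(\frac1q\right)(p(q+1))^{1/q}\left[1-\frac{(q+1)(pq^2+2pq-3q^2+p-2q)}{2q^2(2q+1)}\,\frac1m\right].$$ -/

import Mathlib

open Filter Asymptotics MeasureTheory

noncomputable section

/-- The Abelian integral `F_{p,q}(x) = ∫_0^x (1 - t^q)^{-1/p} dt`, used for `x ∈ [0, 1]`. -/
def arcsinPQ (p q x : ℝ) : ℝ :=
  ∫ t in (0 : ℝ)..x, (1 - t ^ q) ^ (-(1 / p))

/-- The number `π_{p,q} = 2 F_{p,q}(1)`. -/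
def piPQ (p q : ℝ) : ℝ := 2 * arcsinPQ p q 1

/-- The inverse of `F_{p,q} : [0, 1] → [0, π_{p,q} / 2]`. -/
def sinQuarterPQ (p q : ℝ) : ℝ → ℝ :=
  Function.invFunOn (arcsinPQ p q) (Set.Icc 0 1)

/-- `sin_{p,q}` on `[0, π_{p,q}]`, by reflection `sin_{p,q} y = sin_{p,q} (π_{p,q} - y)`. -/
def sinHalfPQ (p q y : ℝ) : ℝ :=
  if y ≤ piPQ p q / 2 then sinQuarterPQ p q y else sinQuarterPQ p q (piPQ p q - y)

/-- The representative of `x` modulo `2 π_{p,q}` in `[-π_{p,q}, π_{p,q})`. -/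
def reducePQ (p q x : ℝ) : ℝ :=
  x - 2 * piPQ p q * (round (x / (2 * piPQ p q)) : ℤ)

/-- The generalised sine `sin_{p,q}` on `ℝ`: the odd, `2 π_{p,q}`-periodic extension. -/
def sinPQ (p q x : ℝ) : ℝ :=
  if 0 ≤ reducePQ p q x then sinHalfPQ p q (reducePQ p q x)
  else -sinHalfPQ p q (-reducePQ p q x)

/-- `I_{p,q}(m) = m^{1/q} ∫_0^∞ |sin_{p,q} x / x|^m dx`. -/
def sincIntegralPQ (p q m : ℝ) : ℝ :=
  m ^ (1 / q) * ∫ x in Set.Ioi (0 : ℝ), |sinPQ p q x / x| ^ m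

/-- `f(m) ~ ∑_j a_j m^{-j}` as `m → ∞` through the reals, as an asymptotic expansion in the
sense of Poincaré (the series need not converge). -/
def HasAsymptoticExpansionAtTop (f : ℝ → ℝ) (a : ℕ → ℝ) : Prop :=
  ∀ N : ℕ, (fun m : ℝ => f m - ∑ j ∈ Finset.range N, a j / m ^ j) =O[atTop]
    fun m : ℝ => 1 / m ^ N

end

open Topology
open scoped ContDiff

/-! This is Laplace's method, with the phase straightened by an analytic change of variable. Write F
for `arcsinPQ p q`. For x = F(s) the quotient sin x / x is s / F(s), and integrating the binomial
series gives F(s) = s (1 + v g(v)) with v = s^q and g analytic at 0 (`exists_analyticAt_arcsinPQ`).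
The phase t = log (1 + v g(v)) is analytic in v with nonzero slope a = 1/(p(q+1)), so v = V(t) is
analytic and x = s e^t = t^(1/q) k(t) with k analytic (`exists_analyticAt_inverse_phase`). Near 0
the integral becomes (1/q) ∫ e^(-mt) t^(1/q-1) h(t) dt with h = k + q t k'. `watson_lemma` then
gives the expansion, whose γ_j are the Taylor coefficients of h.

Away from 0, |sin x / x| ≤ ρ < 1, because F(s) - s is nondecreasing, so that part is exponentially
small (`isBigO_integral_sinPQ_tail`). The first two coefficients need only g(0) and g'(0). -/

/-! ### Watson's lemma -/

theorem integrableOn_exp_neg_mul_mul_rpow {s m : ℝ} (hs : 0 < s) (hm : 0 < m) :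
    IntegrableOn (fun t : ℝ => Real.exp (-m * t) * t ^ (s - 1)) (Set.Ioi 0) := by
  have := integrableOn_rpow_mul_exp_neg_mul_rpow (p := 1) (s := s - 1) (b := m)
    (by linarith) one_pos hm
  refine this.congr_fun (fun t _ => ?_) measurableSet_Ioi
  simp [mul_comm]

theorem integral_exp_neg_mul_mul_rpow {s m : ℝ} (hs : 0 < s) (hm : 0 < m) :
    ∫ t in Set.Ioi (0 : ℝ), Real.exp (-m * t) * t ^ (s - 1) = Real.Gamma s / m ^ s := by
  have := Real.integral_rpow_mul_exp_neg_mul_Ioi hs hm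
  rw [Real.div_rpow zero_le_one hm.le, Real.one_rpow] at this
  rw [div_eq_mul_one_div, mul_comm, ← this]
  refine setIntegral_congr_fun measurableSet_Ioi fun t _ => ?_
  simp [mul_comm]

/-- Watson's lemma, for a function whose expansion at `0` holds with bounds valid on `(0, ∞)`. -/
theorem watson_lemma {α : ℝ} (hα : 0 < α) {h : ℝ → ℝ} {c : ℕ → ℝ}
    (hmeas : AEStronglyMeasurable h (volume.restrict (Set.Ioi 0)))
    (hb : ∀ N : ℕ, ∃ C, ∀ t, 0 < t → |h t - ∑ j ∈ Finset.range N, c j * t ^ j| ≤ C * t ^ N)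
    (N : ℕ) :
    ∃ C, ∀ m : ℝ, 0 < m →
      |m ^ α * (∫ t in Set.Ioi (0 : ℝ), Real.exp (-m * t) * t ^ (α - 1) * h t) -
        ∑ j ∈ Finset.range N, Real.Gamma (j + α) * c j / m ^ j| ≤ C / m ^ N := by
  obtain ⟨C, hC⟩ := hb N
  -- For `N = 0` the sum is empty, so the hypothesis says that `h` is bounded; this gives
  -- integrability.
  obtain ⟨C₀, hC₀⟩ := hb 0
  refine ⟨C * Real.Gamma (N + α), fun m hm => ?_⟩
  have hjα : ∀ j : ℕ, 0 < (j : ℝ) + α := fun j => by positivity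
  have hpow : ∀ (j : ℕ) (t : ℝ), 0 < t → t ^ (α - 1) * t ^ j = t ^ ((j : ℝ) + α - 1) := by
    intro j t ht
    rw [← Real.rpow_natCast, ← Real.rpow_add ht]; ring_nf
  have hI : IntegrableOn (fun t : ℝ => Real.exp (-m * t) * t ^ (α - 1) * h t) (Set.Ioi 0) := by
    refine (integrableOn_exp_neg_mul_mul_rpow hα hm).mul_bdd (c := C₀) hmeas ?_
    filter_upwards [ae_restrict_mem measurableSet_Ioi] with t ht
    simpa using hC₀ t ht
  have hJ : ∀ j : ℕ, IntegrableOn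
      (fun t : ℝ => c j * (Real.exp (-m * t) * t ^ ((j : ℝ) + α - 1))) (Set.Ioi 0) :=
    fun j => (integrableOn_exp_neg_mul_mul_rpow (hjα j) hm).const_mul _
  have hsum : ∑ j ∈ Finset.range N, Real.Gamma (j + α) * c j / m ^ j =
      m ^ α * ∫ t in Set.Ioi (0 : ℝ),
        ∑ j ∈ Finset.range N, c j * (Real.exp (-m * t) * t ^ ((j : ℝ) + α - 1)) := by
    rw [integral_finsetSum _ fun j _ => hJ j, Finset.mul_sum]
    refine Finset.sum_congr rfl fun j _ => ?_
    rw [integral_const_mul, integral_exp_neg_mul_mul_rpow (hjα j) hm, Real.rpow_add hm,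
      Real.rpow_natCast]
    have := (Real.rpow_pos_of_pos hm α).ne'
    field_simp
  rw [hsum, ← mul_sub, ← integral_sub hI (integrable_finsetSum _ fun j _ => hJ j), abs_mul,
    abs_of_pos (Real.rpow_pos_of_pos hm α)]
  have hle : |∫ t in Set.Ioi (0 : ℝ), (Real.exp (-m * t) * t ^ (α - 1) * h t -
      ∑ j ∈ Finset.range N, c j * (Real.exp (-m * t) * t ^ ((j : ℝ) + α - 1)))| ≤
      ∫ t in Set.Ioi (0 : ℝ), C * (Real.exp (-m * t) * t ^ ((N : ℝ) + α - 1)) := by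
    rw [← Real.norm_eq_abs]
    refine norm_integral_le_of_norm_le
      ((integrableOn_exp_neg_mul_mul_rpow (hjα N) hm).const_mul C) ?_
    filter_upwards [ae_restrict_mem measurableSet_Ioi] with t ht
    have ht : 0 < t := ht
    have : Real.exp (-m * t) * t ^ (α - 1) * h t -
        ∑ j ∈ Finset.range N, c j * (Real.exp (-m * t) * t ^ ((j : ℝ) + α - 1)) =
        Real.exp (-m * t) * t ^ (α - 1) * (h t - ∑ j ∈ Finset.range N, c j * t ^ j) := by
      rw [mul_sub, Finset.mul_sum]
      congr 1
      refine Finset.sum_congr rfl fun j _ => ?_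
      rw [← hpow j t ht]; ring
    have hpos : 0 ≤ Real.exp (-m * t) * t ^ (α - 1) := by positivity
    rw [this, Real.norm_eq_abs, abs_mul, abs_of_nonneg hpos, ← hpow N t ht]
    calc _ ≤ Real.exp (-m * t) * t ^ (α - 1) * (C * t ^ N) :=
          mul_le_mul_of_nonneg_left (hC t ht) hpos
      _ = _ := by ring
  refine (mul_le_mul_of_nonneg_left hle (by positivity)).trans (le_of_eq ?_)
  rw [integral_const_mul, integral_exp_neg_mul_mul_rpow (hjα N) hm, Real.rpow_add hm,
    Real.rpow_natCast]
  have := (Real.rpow_pos_of_pos hm α).ne'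
  field_simp

/-- A function with a power series at `0`, cut off at a small `δ`, satisfies the Taylor bounds on
all of `(0, ∞)`. -/
theorem HasFPowerSeriesAt.exists_indicator_taylor_bound {h : ℝ → ℝ}
    {P : FormalMultilinearSeries ℝ ℝ ℝ} (hP : HasFPowerSeriesAt h P 0) :
    ∃ δ₀ > 0, ∀ δ, 0 < δ → δ < δ₀ → ∀ N : ℕ, ∃ C, ∀ t, 0 < t →
      |(Set.Ioc 0 δ).indicator h t - ∑ j ∈ Finset.range N, P.coeff j * t ^ j| ≤ C * t ^ N := by
  obtain ⟨r, hr⟩ := hP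
  obtain ⟨r', hr'0, hr'r⟩ := ENNReal.lt_iff_exists_nnreal_btwn.1 hr.r_pos
  have hr'pos : 0 < (r' : ℝ) := by exact_mod_cast hr'0
  obtain ⟨a, ha, C, hC, hbd⟩ := hr.uniform_geometric_approx' hr'r
  refine ⟨r', hr'pos, fun δ hδ hδr N => ?_⟩
  -- The first summand is the Taylor remainder for t ≤ δ. The second serves t > δ, where only the
  -- polynomial remains and t^j ≤ (δ^j / δ^N) t^N for j < N.
  refine ⟨C * (a / r') ^ N + ∑ j ∈ Finset.range N, |P.coeff j| * (δ ^ j / δ ^ N), fun t ht => ?_⟩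
  have hs : 0 ≤ ∑ j ∈ Finset.range N, |P.coeff j| * (δ ^ j / δ ^ N) :=
    Finset.sum_nonneg fun j _ => by positivity
  have ha0 : 0 < a := ha.1
  by_cases htδ : t ≤ δ
  · rw [Set.indicator_of_mem (show t ∈ Set.Ioc 0 δ from ⟨ht, htδ⟩)]
    have := hbd t (by simp [abs_of_pos ht]; linarith) N
    simp only [zero_add, FormalMultilinearSeries.partialSum, Real.norm_eq_abs, abs_of_pos ht,
      FormalMultilinearSeries.apply_eq_pow_smul_coeff, smul_eq_mul] at this
    simp only [mul_comm (P.coeff _)]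
    refine this.trans ?_
    rw [add_mul]
    have h2 : C * (a * (t / r')) ^ N = C * (a / r') ^ N * t ^ N := by
      rw [mul_assoc, ← mul_pow]; ring_nf
    rw [h2]
    have := mul_nonneg hs (pow_nonneg ht.le N)
    linarith
  · rw [Set.indicator_of_notMem (fun hh => htδ hh.2), zero_sub, abs_neg]
    push Not at htδ
    have h1 : |∑ j ∈ Finset.range N, P.coeff j * t ^ j| ≤
        (∑ j ∈ Finset.range N, |P.coeff j| * (δ ^ j / δ ^ N)) * t ^ N := by
      rw [Finset.sum_mul]
      refine (Finset.abs_sum_le_sum_abs _ _).trans (Finset.sum_le_sum fun j hj => ?_)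
      rw [abs_mul, abs_of_pos (pow_pos ht j), mul_assoc]
      refine mul_le_mul_of_nonneg_left ?_ (abs_nonneg _)
      rw [div_mul_eq_mul_div, le_div_iff₀ (pow_pos hδ N)]
      obtain ⟨i, rfl⟩ := Nat.exists_eq_add_of_le (Finset.mem_range.1 hj).le
      rw [pow_add, pow_add]
      have := pow_le_pow_left₀ hδ.le htδ.le i
      have h3 : 0 ≤ t ^ j * δ ^ j := by positivity
      nlinarith
    rw [add_mul]
    have : 0 ≤ C * (a / r') ^ N * t ^ N := by positivity
    linarith

/-! ### Power series of the Abelian integral -/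

theorem hasSum_one_sub_rpow_neg (a : ℝ) {v : ℝ} (hv : |v| < 1) :
    HasSum (fun n : ℕ => Ring.choose (a + n - 1) n * v ^ n) ((1 - v) ^ (-a)) := by
  have := (Real.one_div_one_sub_rpow_hasFPowerSeriesOnBall_zero a).hasSum (y := v)
    (by simpa [enorm_eq_nnnorm] using! hv)
  rw [Real.rpow_neg (by linarith [(abs_lt.1 hv).2])]
  simpa [FormalMultilinearSeries.apply_eq_pow_smul_coeff, mul_comm] using this

theorem Ring.choose_two_right_real (x : ℝ) : Ring.choose x 2 = x * (x - 1) / 2 := by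
  rw [Ring.choose_eq_smul]
  simp [descPochhammer_succ_right, Polynomial.smeval_mul, Polynomial.smeval_sub,
    Polynomial.smeval_X, Polynomial.smeval_one]
  ring

/-- Termwise integration of a power series in `t ^ q`. -/
theorem hasSum_integral_rpow_series {q s : ℝ} (hq : 0 < q) (hs : 0 ≤ s) {c : ℕ → ℝ} {f : ℝ → ℝ}
    (hc : Summable fun n => |c n| * (s ^ q) ^ n)
    (hf : ∀ t ∈ Set.Icc 0 s, HasSum (fun n => c n * (t ^ q) ^ n) (f t)) :
    HasSum (fun n : ℕ => s * (c n / (q * n + 1) * (s ^ q) ^ n)) (∫ t in (0 : ℝ)..s, f t) := by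
  have key := intervalIntegral.hasSum_integral_of_dominated_convergence (μ := volume)
    (a := 0) (b := s) (F := fun n t => c n * (t ^ q) ^ n) (f := f)
    (fun n _ => |c n| * (s ^ q) ^ n) (fun n => by
      refine Continuous.aestronglyMeasurable ?_
      exact continuous_const.mul ((Real.continuous_rpow_const hq.le).pow n))
    (fun n => ae_of_all _ fun t ht => by
      rw [Set.uIoc_of_le hs] at ht
      have h1 : 0 ≤ t ^ q := Real.rpow_nonneg ht.1.le q
      rw [norm_mul, norm_pow, Real.norm_eq_abs, Real.norm_eq_abs, abs_of_nonneg h1]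
      have h2 : t ^ q ≤ s ^ q := Real.rpow_le_rpow ht.1.le ht.2 hq.le
      gcongr)
    (ae_of_all _ fun t _ => hc) (by simp)
    (ae_of_all _ fun t ht => by
      rw [Set.uIoc_of_le hs] at ht
      exact hf t ⟨ht.1.le, ht.2⟩)
  refine key.congr_fun ?_
  intro n
  have hn : 0 < q * n + 1 := by positivity
  rw [intervalIntegral.integral_const_mul]
  have : ∫ t in (0 : ℝ)..s, (t ^ q) ^ n = s ^ (q * n + 1) / (q * n + 1) := by
    have h2 : ∫ t in (0 : ℝ)..s, (t ^ q) ^ n = ∫ t in (0 : ℝ)..s, t ^ (q * n) := by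
      refine intervalIntegral.integral_congr fun t ht => ?_
      rw [Set.uIcc_of_le hs] at ht
      simp [Real.rpow_mul ht.1]
    rw [h2, integral_rpow (Or.inl (by nlinarith [mul_nonneg hq.le (Nat.cast_nonneg (α := ℝ) n)])),
      Real.zero_rpow hn.ne', sub_zero]
  rw [this, Real.rpow_add_one' hs hn.ne', Real.rpow_mul hs, Real.rpow_natCast]
  ring

/-- `F_{p,q}(s) = s (1 + s^q g(s^q))` with `g` analytic at `0`. -/
theorem exists_analyticAt_arcsinPQ {p q : ℝ} (hp : 1 < p) (hq : 1 < q) :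
    ∃ g : ℝ → ℝ, AnalyticAt ℝ g 0 ∧ g 0 = 1 / (p * (q + 1)) ∧
      deriv g 0 = (p + 1) / (2 * p ^ 2 * (2 * q + 1)) ∧
      ∀ s, 0 ≤ s → s < 1 → arcsinPQ p q s = s * (1 + s ^ q * g (s ^ q)) := by
  set c : ℕ → ℝ := fun n => Ring.choose (1 / p + n - 1) n with hcdef
  set d : ℕ → ℝ := fun n => c n / (q * n + 1) with hddef
  have hcs : ∀ v : ℝ, 0 ≤ v → v < 1 → Summable fun n => |c n| * v ^ n := by
    intro v hv hv1
    have := (hasSum_one_sub_rpow_neg (1 / p) (v := v) (by rwa [abs_of_nonneg hv])).summable.abs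
    simpa [hcdef, abs_mul, abs_of_nonneg hv] using this
  have hds : ∀ v : ℝ, |v| < 1 → Summable fun n => d n * v ^ n := by
    intro v hv
    refine Summable.of_norm_bounded (hcs |v| (abs_nonneg v) hv) fun n => ?_
    rw [norm_mul, norm_pow, Real.norm_eq_abs, Real.norm_eq_abs]
    refine mul_le_mul_of_nonneg_right ?_ (by positivity)
    have : 1 ≤ q * n + 1 := by
      nlinarith [mul_nonneg (by linarith : (0 : ℝ) ≤ q) (Nat.cast_nonneg (α := ℝ) n)]
    simp only [hddef]
    rw [abs_div, abs_of_pos (by linarith : 0 < q * n + 1)]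
    exact div_le_self (abs_nonneg _) this
  have hds' : ∀ v : ℝ, |v| < 1 → Summable fun n => d (n + 1) * v ^ n := by
    intro v hv
    by_cases hv0 : v = 0
    · subst hv0
      exact summable_of_ne_finset_zero (s := {0}) fun n hn => by
        simp at hn; simp [hn]
    · have := ((summable_nat_add_iff 1).2 (hds v hv)).mul_right v⁻¹
      refine this.congr fun n => ?_
      field_simp
      ring
  -- Since `d 0 = 1`, the shifted series is the g in ∑ d n v^n = 1 + v g(v). Hence g(0) = `d 1` and
  -- g'(0) = `d 2`.
  have hP : HasFPowerSeriesAt (fun v : ℝ => ∑' n, d (n + 1) * v ^ n)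
      (FormalMultilinearSeries.ofScalars ℝ fun n => d (n + 1)) 0 := by
    rw [hasFPowerSeriesAt_iff]
    filter_upwards [Metric.ball_mem_nhds (0 : ℝ) one_pos] with v hv
    have := (hds' v (by simpa using hv)).hasSum
    simpa [FormalMultilinearSeries.coeff_ofScalars, mul_comm] using this
  refine ⟨_, hP.analyticAt, ?_, ?_, ?_⟩
  · have := hP.coeff_zero 0
    simp only [← this]
    simp [hddef, hcdef]
    field_simp
  · rw [hP.deriv]
    simp [hddef, hcdef, Ring.choose_two_right_real]
    field_simp
    ring
  · intro s hs hs1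
    have hv0 : 0 ≤ s ^ q := Real.rpow_nonneg hs q
    have hv1 : s ^ q < 1 := Real.rpow_lt_one hs hs1 (by linarith)
    have h1 := hasSum_integral_rpow_series (q := q) (by linarith) hs (hcs _ hv0 hv1)
      (f := fun t => (1 - t ^ q) ^ (-(1 / p))) fun t ht =>
        hasSum_one_sub_rpow_neg (1 / p) (by
          rw [abs_of_nonneg (Real.rpow_nonneg ht.1 q)]
          exact Real.rpow_lt_one ht.1 (ht.2.trans_lt hs1) (by linarith))
    have h2 : HasSum (fun n => d n * (s ^ q) ^ n)
        (1 + s ^ q * ∑' n, d (n + 1) * (s ^ q) ^ n) := by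
      have h3 := ((hds' (s ^ q) (by rwa [abs_of_nonneg hv0])).hasSum.mul_left (s ^ q))
      rw [← hasSum_nat_add_iff' 1]
      simp only [Finset.range_one, Finset.sum_singleton, pow_zero, mul_one]
      have hd0 : d 0 = 1 := by simp [hddef, hcdef]
      rw [hd0, add_sub_cancel_left]
      refine h3.congr_fun ?_
      intro n
      ring
    exact h1.unique (h2.mul_left s)

/-! ### Inversion of the phase -/

/-- The singularity of a difference quotient is removable. This lets a factor t be split off the
inverse phase at its zero. -/
theorem AnalyticAt.dslope_self {f : ℝ → ℝ} {x : ℝ} (hf : AnalyticAt ℝ f x) :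
    AnalyticAt ℝ (dslope f x) x :=
  let ⟨_, hP⟩ := hf
  hP.has_fpower_series_dslope_fslope.analyticAt

theorem deriv_dslope_exp_zero : deriv (dslope Real.exp 0) 0 = 1 / 2 := by
  have h : HasFPowerSeriesAt Real.exp (NormedSpace.expSeries ℝ ℝ) 0 := by
    rw [Real.exp_eq_exp_ℝ]
    exact NormedSpace.exp_hasFPowerSeriesAt_zero
  have h2 := h.has_fpower_series_dslope_fslope.deriv
  rw [h2]
  simp [NormedSpace.expSeries_eq_ofScalars, FormalMultilinearSeries.coeff_ofScalars]

/-- Inversion of the phase `t = log (1 + v g(v))`. -/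
theorem exists_analyticAt_inverse_phase {q a b : ℝ} (hq : 0 < q) (ha : 0 < a) {g : ℝ → ℝ}
    (hg : AnalyticAt ℝ g 0) (hg0 : g 0 = a) (hg1 : deriv g 0 = b) :
    ∃ k V : ℝ → ℝ, AnalyticAt ℝ k 0 ∧ k 0 = (1 / a) ^ (1 / q) ∧
      deriv k 0 = (1 / a) ^ (1 / q) * (1 - (b / a ^ 2 - 1 / 2) / q) ∧
      ContinuousAt V 0 ∧ V 0 = 0 ∧
      ∀ᶠ t in 𝓝 (0 : ℝ), 0 < t → 0 < V t ∧ 1 + V t * g (V t) = Real.exp t ∧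
        V t ^ (1 / q) * Real.exp t = t ^ (1 / q) * k t := by
  set y : ℝ → ℝ := fun v => 1 + v * g v with hy
  have hya : AnalyticAt ℝ y 0 := analyticAt_const.add (analyticAt_id.mul hg)
  have hy0 : y 0 = 1 := by simp [hy]
  have hyd : HasDerivAt y a 0 := by
    have := ((hasDerivAt_id (0 : ℝ)).mul hg.differentiableAt.hasDerivAt).const_add 1
    simpa [hg0, hy] using! this
  set G : ℝ → ℝ := fun v => Real.log (y v) with hG
  have hGa : AnalyticAt ℝ G 0 := hya.log (by rw [hy0]; exact one_pos)
  have hG0 : G 0 = 0 := by simp [hG, hy0]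
  have hGd : deriv G 0 = a := by
    have := (hyd.log (by rw [hy0]; exact one_ne_zero)).deriv
    rw [hy0, div_one] at this
    exact this
  have hGne : deriv G 0 ≠ 0 := by rw [hGd]; exact ha.ne'
  -- The slope a of the phase at 0 is nonzero, so the analytic inverse function theorem applies.
  set V := hGa.hasStrictDerivAt.localInverse _ _ _ hGne with hV
  have hVa : AnalyticAt ℝ V 0 := by
    have := hGa.analyticAt_localInverse hGne
    rwa [hG0] at this
  have hV0 : V 0 = 0 := by
    have : V (G 0) = 0 := HasStrictFDerivAt.localInverse_apply_image ..
    rwa [hG0] at this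
  have hVr : ∀ᶠ t in 𝓝 (0 : ℝ), G (V t) = t := by
    have : ∀ᶠ t in 𝓝 (G 0), G (V t) = t :=
      HasStrictDerivAt.eventually_right_inverse hGa.hasStrictDerivAt hGne
    rwa [hG0] at this
  have hVd : deriv V 0 = 1 / a := by
    have := (hGa.hasStrictDerivAt.to_localInverse hGne).hasDerivAt.deriv
    rw [hG0] at this
    rw [one_div, ← hGd]
    exact this
  have hpos : ∀ᶠ t in 𝓝 (0 : ℝ), 0 < y (V t) := by
    have hc : ContinuousAt (fun t => y (V t)) 0 :=
      ContinuousAt.comp (g := y) (by rw [hV0]; exact hya.continuousAt) hVa.continuousAt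
    exact hc.eventually (lt_mem_nhds (by simp [hV0, hy0]))
  have hexp : ∀ᶠ t in 𝓝 (0 : ℝ), y (V t) = Real.exp t := by
    filter_upwards [hVr, hpos] with t h1 h2
    rw [← Real.exp_log h2]
    exact congrArg Real.exp h1
  set W := dslope V 0 with hW
  have hWa : AnalyticAt ℝ W 0 := hVa.dslope_self
  have hW0 : W 0 = 1 / a := by rw [hW, dslope_same, hVd]
  have hVW : ∀ t, V t = t * W t := fun t => by
    have := sub_smul_dslope V 0 t
    simp [hV0] at this
    exact this.symm
  -- Dividing 1 + V g(V) = e^t by t gives W g(V) = (e^t - 1)/t. Differentiating at 0 gives a W'(0) +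
  -- b/a² = 1/2.
  have hWd : HasDerivAt W ((1 / 2 - b / a ^ 2) / a) 0 := by
    have hgV : HasDerivAt (fun t => W t * g (V t)) (deriv W 0 * a + 1 / a * (b * (1 / a))) 0 := by
      have h1 : HasDerivAt (fun t => g (V t)) (b * (1 / a)) 0 := by
        have h2 : HasDerivAt g b (V 0) := by
          rw [hV0, ← hg1]; exact hg.differentiableAt.hasDerivAt
        have h3 : HasDerivAt V (1 / a) 0 := by
          rw [← hVd]; exact hVa.differentiableAt.hasDerivAt
        exact h2.comp 0 h3
      have := hWa.differentiableAt.hasDerivAt.mul h1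
      rwa [hV0, hg0, hW0] at this
    have heq : (fun t => W t * g (V t)) =ᶠ[𝓝 0] dslope Real.exp 0 := by
      filter_upwards [hexp] with t ht
      by_cases h0 : t = 0
      · subst h0
        rw [hV0, hg0, hW0, dslope_same, Real.deriv_exp, Real.exp_zero]
        field_simp
      · rw [dslope_of_ne _ h0, slope_def_field, ← ht, Real.exp_zero, sub_zero, hy, eq_div_iff h0]
        simp only
        linear_combination (-g (V t)) * hVW t
    have hd := hgV.deriv
    rw [heq.deriv_eq, deriv_dslope_exp_zero] at hd
    have : deriv W 0 = (1 / 2 - b / a ^ 2) / a := by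
      field_simp at hd ⊢
      linarith
    rw [← this]
    exact hWa.differentiableAt.hasDerivAt
  have hWpos : ∀ᶠ t in 𝓝 (0 : ℝ), 0 < W t :=
    hWa.continuousAt.eventually (lt_mem_nhds (by rw [hW0]; positivity))
  -- V^(1/q) = t^(1/q) W^(1/q) for small t > 0, and W^(1/q) is analytic because W(0) = 1/a > 0.
  refine ⟨fun t => W t ^ (1 / q) * Real.exp t, V, ?_, ?_, ?_, hVa.continuousAt, hV0, ?_⟩
  · exact ((hWa.contDiffAt (n := ω)).rpow_const_of_ne (by rw [hW0]; positivity)).analyticAt.mul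
      analyticAt_rexp
  · simp [hW0]
  · have h1 := (hWd.rpow_const (p := 1 / q) (Or.inl (by rw [hW0]; positivity))).mul
      (Real.hasDerivAt_exp 0)
    refine h1.deriv.trans ?_
    rw [hW0, Real.exp_zero, Real.rpow_sub_one (by positivity)]
    field_simp
    ring
  · filter_upwards [hexp, hWpos] with t h1 h2 ht
    refine ⟨by rw [hVW]; positivity, h1, ?_⟩
    rw [hVW, Real.mul_rpow ht.le h2.le, mul_assoc]

/-! ### Monotonicity, measurability and bounds for the generalised sine -/

section GeneralisedSine

variable {p q : ℝ}

theorem one_sub_le_one_sub_rpow (hq : 1 < q) {t : ℝ} (ht : t ∈ Set.Icc (0 : ℝ) 1) :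
    1 - t ≤ 1 - t ^ q := by
  have := Real.rpow_le_rpow_of_exponent_ge' ht.1 ht.2 zero_le_one hq.le
  rw [Real.rpow_one] at this
  linarith

theorem one_le_arcsinPQ_integrand (hp : 1 < p) (hq : 1 < q) {t : ℝ} (ht : t ∈ Set.Ico (0 : ℝ) 1) :
    1 ≤ (1 - t ^ q) ^ (-(1 / p)) := by
  have h1 := one_sub_le_one_sub_rpow hq ⟨ht.1, ht.2.le⟩
  have h2 := Real.rpow_nonneg ht.1 q
  exact Real.one_le_rpow_of_pos_of_le_one_of_nonpos (by linarith [ht.2]) (by linarith)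
    (neg_nonpos.2 (by positivity))

/-- Since 1 - t ≤ 1 - t^q, the integrand is dominated by (1 - t)^(-1/p), whose exponent exceeds -1.
-/
theorem intervalIntegrable_arcsinPQ_integrand (hp : 1 < p) (hq : 1 < q) :
    IntervalIntegrable (fun t : ℝ => (1 - t ^ q) ^ (-(1 / p))) volume 0 1 := by
  have h1p : 1 / p < 1 := by rw [div_lt_one (by linarith)]; exact hp
  have h : IntervalIntegrable (fun t : ℝ => (1 - t) ^ (-(1 / p))) volume 0 1 := by
    have := (intervalIntegral.intervalIntegrable_rpow' (a := 0) (b := 1) (r := -(1 / p))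
      (by linarith)).comp_sub_left 1
    simpa using this.symm
  refine h.mono_fun ?_ ?_
  · exact (by fun_prop : Measurable fun t : ℝ => (1 - t ^ q) ^ (-(1 / p))).aestronglyMeasurable
  · filter_upwards [ae_restrict_mem measurableSet_uIoc,
      ae_restrict_of_ae (Measure.ae_ne volume (1 : ℝ))] with t ht ht1
    rw [Set.uIoc_of_le zero_le_one] at ht
    have hlt : t < 1 := lt_of_le_of_ne ht.2 ht1
    have h1 := one_sub_le_one_sub_rpow hq ⟨ht.1.le, ht.2⟩
    rw [Real.norm_of_nonneg (Real.rpow_nonneg (by linarith) _),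
      Real.norm_of_nonneg (Real.rpow_nonneg (by linarith) _)]
    exact Real.rpow_le_rpow_of_nonpos (by linarith) h1 (neg_nonpos.2 (by positivity))

@[simp] theorem arcsinPQ_zero : arcsinPQ p q 0 = 0 := by simp [arcsinPQ]

/-- The integrand is at least 1, so F(s) - s is nondecreasing. Both the injectivity of F and the
decay away from 0 rest on this. -/
theorem sub_le_arcsinPQ_sub (hp : 1 < p) (hq : 1 < q) {s s' : ℝ} (hs : 0 ≤ s) (hss : s ≤ s')
    (hs' : s' ≤ 1) : s' - s ≤ arcsinPQ p q s' - arcsinPQ p q s := by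
  have hI := intervalIntegrable_arcsinPQ_integrand hp hq
  have h0 : ∀ a b : ℝ, 0 ≤ a → a ≤ b → b ≤ 1 →
      IntervalIntegrable (fun t : ℝ => (1 - t ^ q) ^ (-(1 / p))) volume a b := by
    intro a b ha hab hb
    refine hI.mono_set ?_
    rw [Set.uIcc_of_le hab, Set.uIcc_of_le zero_le_one]
    exact Set.Icc_subset_Icc ha hb
  rw [arcsinPQ, arcsinPQ, intervalIntegral.integral_interval_sub_left
    (h0 0 s' le_rfl (hs.trans hss) hs') (h0 0 s le_rfl hs (hss.trans hs'))]
  have := intervalIntegral.integral_mono_on_of_le_Ioo hss (f := fun _ => (1 : ℝ)) (by simp)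
    (h0 s s' hs hss hs') fun t ht =>
      one_le_arcsinPQ_integrand hp hq ⟨hs.trans ht.1.le, ht.2.trans_le hs'⟩
  simpa using this

theorem strictMonoOn_arcsinPQ (hp : 1 < p) (hq : 1 < q) :
    StrictMonoOn (arcsinPQ p q) (Set.Icc 0 1) := fun s hs s' hs' h => by
  have := sub_le_arcsinPQ_sub hp hq hs.1 h.le hs'.2
  linarith

theorem continuousOn_arcsinPQ (hp : 1 < p) (hq : 1 < q) :
    ContinuousOn (arcsinPQ p q) (Set.Icc 0 1) := by
  have := intervalIntegral.continuousOn_primitive_interval'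
    (intervalIntegrable_arcsinPQ_integrand hp hq) Set.left_mem_uIcc
  rwa [Set.uIcc_of_le zero_le_one] at this

theorem one_le_arcsinPQ_one (hp : 1 < p) (hq : 1 < q) : 1 ≤ arcsinPQ p q 1 := by
  have := sub_le_arcsinPQ_sub hp hq le_rfl zero_le_one le_rfl
  simpa using this

theorem exists_arcsinPQ_eq (hp : 1 < p) (hq : 1 < q) {x : ℝ} (hx : 0 ≤ x)
    (hx1 : x ≤ arcsinPQ p q 1) : ∃ s ∈ Set.Icc (0 : ℝ) 1, arcsinPQ p q s = x := by
  have := intermediate_value_Icc zero_le_one (continuousOn_arcsinPQ hp hq)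
  rw [arcsinPQ_zero] at this
  exact this ⟨hx, hx1⟩

theorem sinQuarterPQ_arcsinPQ (hp : 1 < p) (hq : 1 < q) {s : ℝ} (hs : s ∈ Set.Icc (0 : ℝ) 1) :
    sinQuarterPQ p q (arcsinPQ p q s) = s :=
  (strictMonoOn_arcsinPQ hp hq).injOn.leftInvOn_invFunOn hs

theorem piPQ_half : piPQ p q / 2 = arcsinPQ p q 1 := by simp [piPQ]

theorem piPQ_pos (hp : 1 < p) (hq : 1 < q) : 0 < piPQ p q := by
  have := one_le_arcsinPQ_one hp hq
  rw [piPQ]; linarith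

theorem arcsinPQ_mem_Icc (hp : 1 < p) (hq : 1 < q) {s : ℝ} (hs : s ∈ Set.Icc (0 : ℝ) 1) :
    arcsinPQ p q s ∈ Set.Icc 0 (arcsinPQ p q 1) := by
  have h := (strictMonoOn_arcsinPQ hp hq).monotoneOn
  refine ⟨?_, h hs (Set.right_mem_Icc.2 zero_le_one) hs.2⟩
  simpa using h (Set.left_mem_Icc.2 zero_le_one) hs hs.1

theorem sinPQ_arcsinPQ (hp : 1 < p) (hq : 1 < q) {s : ℝ} (hs : s ∈ Set.Icc (0 : ℝ) 1) :
    sinPQ p q (arcsinPQ p q s) = s := by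
  have hpi := piPQ_pos hp hq
  have hF := arcsinPQ_mem_Icc hp hq hs
  rw [← piPQ_half] at hF
  have hr : round (arcsinPQ p q s / (2 * piPQ p q)) = 0 := by
    rw [round_eq_zero_iff]
    constructor
    · have : 0 ≤ arcsinPQ p q s / (2 * piPQ p q) := div_nonneg hF.1 (by positivity)
      linarith
    · rw [div_lt_iff₀ (by positivity)]
      linarith [hF.2]
  have hred : reducePQ p q (arcsinPQ p q s) = arcsinPQ p q s := by simp [reducePQ, hr]
  rw [sinPQ, hred, if_pos hF.1, sinHalfPQ, if_pos hF.2, sinQuarterPQ_arcsinPQ hp hq hs]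

theorem sinQuarterPQ_mem_Icc (hp : 1 < p) (hq : 1 < q) {x : ℝ}
    (hx : x ∈ Set.Icc 0 (arcsinPQ p q 1)) : sinQuarterPQ p q x ∈ Set.Icc (0 : ℝ) 1 := by
  obtain ⟨s, hs, rfl⟩ := exists_arcsinPQ_eq hp hq hx.1 hx.2
  rwa [sinQuarterPQ_arcsinPQ hp hq hs]

theorem abs_reducePQ_le (hp : 1 < p) (hq : 1 < q) (x : ℝ) : |reducePQ p q x| ≤ piPQ p q := by
  have hpi := piPQ_pos hp hq
  have h := abs_sub_round (x / (2 * piPQ p q))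
  have : reducePQ p q x =
      2 * piPQ p q * (x / (2 * piPQ p q) - (round (x / (2 * piPQ p q)) : ℤ)) := by
    rw [reducePQ]; field_simp
  rw [this, abs_mul, abs_of_pos (by positivity)]
  nlinarith

theorem abs_sinPQ_le_one (hp : 1 < p) (hq : 1 < q) (x : ℝ) : |sinPQ p q x| ≤ 1 := by
  have hhalf : ∀ y, 0 ≤ y → y ≤ piPQ p q → |sinHalfPQ p q y| ≤ 1 := by
    intro y hy hy1
    rw [sinHalfPQ]
    have h2 := piPQ_half (p := p) (q := q)
    split_ifs with h
    · have := sinQuarterPQ_mem_Icc hp hq (x := y) ⟨hy, by rwa [← h2]⟩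
      rw [abs_of_nonneg this.1]; exact this.2
    · have := sinQuarterPQ_mem_Icc hp hq (x := piPQ p q - y) ⟨by linarith, by linarith⟩
      rw [abs_of_nonneg this.1]; exact this.2
  have hr := abs_le.1 (abs_reducePQ_le hp hq x)
  rw [sinPQ]
  split_ifs with h
  · exact hhalf _ h hr.2
  · rw [abs_neg]
    exact hhalf _ (by linarith) (by linarith)

theorem measurable_sinPQ (hp : 1 < p) (hq : 1 < q) : Measurable (sinPQ p q) := by
  have hpi := piPQ_pos hp hq
  have hF1 := one_le_arcsinPQ_one hp hq
  have h2 := piPQ_half (p := p) (q := q)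
  -- Nothing is known of `sinQuarterPQ` off [0, F(1)]. Clamping the argument gives a globally
  -- monotone, hence measurable, function.
  set S : ℝ → ℝ := fun z => sinQuarterPQ p q (max 0 (min z (arcsinPQ p q 1))) with hS
  have hmono : Monotone S := by
    have hm : MonotoneOn (sinQuarterPQ p q) (Set.Icc 0 (arcsinPQ p q 1)) := by
      intro x hx y hy hxy
      obtain ⟨s, hs, rfl⟩ := exists_arcsinPQ_eq hp hq hx.1 hx.2
      obtain ⟨s', hs', rfl⟩ := exists_arcsinPQ_eq hp hq hy.1 hy.2
      rw [sinQuarterPQ_arcsinPQ hp hq hs, sinQuarterPQ_arcsinPQ hp hq hs']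
      exact ((strictMonoOn_arcsinPQ hp hq).le_iff_le hs hs').1 hxy
    intro x y hxy
    have hmem : ∀ z, max 0 (min z (arcsinPQ p q 1)) ∈ Set.Icc 0 (arcsinPQ p q 1) := fun z =>
      ⟨le_max_left _ _, max_le (by linarith) (min_le_right _ _)⟩
    exact hm (hmem x) (hmem y) (max_le_max le_rfl (min_le_min hxy le_rfl))
  have hSeq : ∀ z, 0 ≤ z → z ≤ arcsinPQ p q 1 → sinQuarterPQ p q z = S z := by
    intro z hz hz1
    simp [hS, hz, hz1]
  have hSm : Measurable S := hmono.measurable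
  have hred : Measurable (reducePQ p q) := by
    unfold reducePQ
    simp only [round_eq]
    have : Measurable fun x : ℝ => ((⌊x / (2 * piPQ p q) + 1 / 2⌋ : ℤ) : ℝ) :=
      (measurable_from_top (f := fun n : ℤ => (n : ℝ))).comp
        (Int.measurable_floor.comp (by fun_prop))
    exact measurable_id.sub (measurable_const.mul this)
  set H : ℝ → ℝ := fun y => if y ≤ piPQ p q / 2 then S y else S (piPQ p q - y) with hH
  have hHm : Measurable H :=
    Measurable.ite measurableSet_Iic hSm (hSm.comp (measurable_const.sub measurable_id))
  have hHeq : ∀ y, 0 ≤ y → y ≤ piPQ p q → sinHalfPQ p q y = H y := by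
    intro y hy hy1
    simp only [sinHalfPQ, hH]
    split_ifs with h
    · exact hSeq y hy (by linarith)
    · exact hSeq _ (by linarith) (by linarith)
  have : sinPQ p q = fun x => if 0 ≤ reducePQ p q x then H (reducePQ p q x)
      else -H (-reducePQ p q x) := by
    funext x
    have hr := abs_le.1 (abs_reducePQ_le hp hq x)
    rw [sinPQ]
    split_ifs with h
    · exact hHeq _ h hr.2
    · rw [hHeq _ (by linarith) (by linarith)]
  rw [this]
  exact Measurable.ite (measurableSet_le measurable_const hred) (hHm.comp hred)
    (hHm.comp hred.neg).neg

/-- Beyond the point `F(s₀)` the quotient `sin x / x` is bounded by `1 / (1 + F(s₀) - s₀)`. -/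
theorem abs_sinPQ_div_le (hp : 1 < p) (hq : 1 < q) {s₀ x : ℝ} (hs₀ : s₀ ∈ Set.Icc (0 : ℝ) 1)
    (hx : 0 < x) (hsx : arcsinPQ p q s₀ ≤ x) :
    |sinPQ p q x / x| ≤ 1 / (1 + (arcsinPQ p q s₀ - s₀)) := by
  have hη : 0 ≤ arcsinPQ p q s₀ - s₀ := by
    have := sub_le_arcsinPQ_sub hp hq le_rfl hs₀.1 hs₀.2
    simpa using this
  rw [abs_div, abs_of_pos hx, div_le_div_iff₀ hx (by linarith), one_mul]
  -- Put η = F(s₀) - s₀. If x = F(s) then x ≥ s + η ≥ s(1 + η), as s ≤ 1; past F(1), x > F(1) ≥ 1 +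
  -- η while |sin x| ≤ 1.
  by_cases hx1 : x ≤ arcsinPQ p q 1
  · obtain ⟨s, hs, rfl⟩ := exists_arcsinPQ_eq hp hq hx.le hx1
    rw [sinPQ_arcsinPQ hp hq hs, abs_of_nonneg hs.1]
    have hss : s₀ ≤ s := ((strictMonoOn_arcsinPQ hp hq).le_iff_le hs₀ hs).1 hsx
    have := sub_le_arcsinPQ_sub hp hq hs₀.1 hss hs.2
    nlinarith [hs.2]
  · have := sub_le_arcsinPQ_sub hp hq hs₀.1 hs₀.2 le_rfl
    have h1 := abs_sinPQ_le_one hp hq x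
    push Not at hx1
    nlinarith

theorem abs_sinPQ_div_le_one (hp : 1 < p) (hq : 1 < q) {x : ℝ} (hx : 0 < x) :
    |sinPQ p q x / x| ≤ 1 := by
  have := abs_sinPQ_div_le hp hq (Set.left_mem_Icc.2 zero_le_one) hx (by simpa using hx.le)
  simpa using this

/-- The integrand is at most 1 on (0, 1] and at most x^(-m) beyond. -/
theorem integrableOn_abs_sinPQ_div_rpow (hp : 1 < p) (hq : 1 < q) {m : ℝ} (hm : 1 < m) :
    IntegrableOn (fun x : ℝ => |sinPQ p q x / x| ^ m) (Set.Ioi 0) := by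
  have hmeas : Measurable fun x : ℝ => |sinPQ p q x / x| ^ m :=
    (((measurable_sinPQ hp hq).div measurable_id).abs).pow_const m
  rw [← Set.Ioc_union_Ioi_eq_Ioi zero_le_one]
  refine IntegrableOn.union ?_ ?_
  · refine Measure.integrableOn_of_bounded (M := 1) (by simp) hmeas.aestronglyMeasurable ?_
    filter_upwards [ae_restrict_mem measurableSet_Ioc] with x hx
    rw [Real.norm_of_nonneg (by positivity)]
    exact Real.rpow_le_one (abs_nonneg _) (abs_sinPQ_div_le_one hp hq hx.1) (by linarith)
  · refine Integrable.mono' (integrableOn_Ioi_rpow_of_lt (a := -m) (by linarith) one_pos)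
      hmeas.aestronglyMeasurable ?_
    filter_upwards [ae_restrict_mem measurableSet_Ioi] with x hx
    have hx0 : 0 < x := one_pos.trans hx
    rw [Real.norm_of_nonneg (by positivity), Real.rpow_neg hx0.le, ← Real.inv_rpow hx0.le]
    refine Real.rpow_le_rpow (abs_nonneg _) ?_ (by linarith)
    rw [abs_div, abs_of_pos hx0, ← one_div]
    exact div_le_div_of_nonneg_right (abs_sinPQ_le_one hp hq x) hx0.le

end GeneralisedSine

/-! ### Reduction to a Laplace integral, and the tail -/

/-- The substitution `sin x / x = exp (-t)` near `x = 0`. -/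
theorem exists_analyticAt_integral_sinPQ {p q : ℝ} (hp : 1 < p) (hq : 1 < q) :
    ∃ h : ℝ → ℝ, AnalyticAt ℝ h 0 ∧ h 0 = (p * (q + 1)) ^ (1 / q) ∧
      deriv h 0 = (p * (q + 1)) ^ (1 / q) *
        ((q + 1) * (1 - ((p + 1) * (q + 1) ^ 2 / (2 * (2 * q + 1)) - 1 / 2) / q)) ∧
      ∃ δ₁ > 0, ∀ δ, 0 < δ → δ < δ₁ → ContinuousOn h (Set.Ioc 0 δ) ∧
        ∃ s₀ ∈ Set.Ioo (0 : ℝ) 1, s₀ < arcsinPQ p q s₀ ∧ ∀ m : ℝ,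
          ∫ x in Set.Ioc 0 (arcsinPQ p q s₀), |sinPQ p q x / x| ^ m =
            1 / q * ∫ t in Set.Ioc 0 δ, Real.exp (-m * t) * t ^ (1 / q - 1) * h t := by
  have hp0 : 0 < p := by linarith
  have hq0 : 0 < q := by linarith
  have hα : 0 < 1 / q := by positivity
  obtain ⟨g, hga, hg0, hg1, hgF⟩ := exists_analyticAt_arcsinPQ hp hq
  obtain ⟨k, V, hka, hk0, hk1, hVc, hV0, hev⟩ :=
    exists_analyticAt_inverse_phase hq0 (by positivity) hga hg0 hg1
  rw [one_div_one_div] at hk0 hk1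
  -- Chosen so that the derivative of t^(1/q) k(t) is (1/q) t^(1/q-1) h(t).
  set h : ℝ → ℝ := fun t => k t + q * (t * deriv k t) with hh
  have hha : AnalyticAt ℝ h 0 :=
    hka.add (analyticAt_const.mul (analyticAt_id.mul hka.deriv))
  have hh0 : h 0 = (p * (q + 1)) ^ (1 / q) := by simp [hh, hk0]
  have hh1 : deriv h 0 = (1 + q) * deriv k 0 := by
    have h1 := hka.differentiableAt.hasDerivAt
    have h2 := ((hasDerivAt_id (0 : ℝ)).mul hka.deriv.differentiableAt.hasDerivAt).const_mul q
    have h3 := (h1.add h2).deriv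
    have h4 : deriv h 0 = deriv k 0 + q * (1 * deriv k 0 + id 0 * deriv (deriv k) 0) := h3
    rw [h4]
    simp only [id]
    ring
  have hhpos : ∀ᶠ t in 𝓝 (0 : ℝ), 0 < h t :=
    hha.continuousAt.eventually (lt_mem_nhds (by rw [hh0]; positivity))
  have hVlt : ∀ᶠ t in 𝓝 (0 : ℝ), V t < 1 :=
    hVc.eventually (gt_mem_nhds (by rw [hV0]; exact one_pos))
  obtain ⟨δ₁, hδ₁, hball⟩ := Metric.eventually_nhds_iff_ball.1
    (hev.and (hhpos.and (hVlt.and (hka.eventually_analyticAt.and hha.eventually_analyticAt))))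
  refine ⟨h, hha, hh0, ?_, δ₁, hδ₁, fun δ hδ hδδ => ?_⟩
  · rw [hh1, hk1]
    field_simp
    ring
  have hmem : ∀ t ∈ Set.Icc 0 δ, t ∈ Metric.ball (0 : ℝ) δ₁ := fun t ht => by
    rw [mem_ball_zero_iff, Real.norm_of_nonneg ht.1]
    exact ht.2.trans_lt hδδ
  have hIcc : ∀ {t}, t ∈ Set.Ioc 0 δ → t ∈ Set.Icc 0 δ := fun ht => ⟨ht.1.le, ht.2⟩
  refine ⟨fun t ht =>
    (hball t (hmem t (hIcc ht))).2.2.2.2.continuousAt.continuousWithinAt, ?_⟩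
  set X : ℝ → ℝ := fun t => t ^ (1 / q) * k t with hX
  have hX0 : X 0 = 0 := by
    simp only [hX]
    rw [Real.zero_rpow hα.ne', zero_mul]
  have hXF : ∀ t ∈ Set.Ioc 0 δ, V t ^ (1 / q) ∈ Set.Ioo (0 : ℝ) 1 ∧
      arcsinPQ p q (V t ^ (1 / q)) = X t ∧ V t ^ (1 / q) * Real.exp t = X t := by
    intro t ht
    obtain ⟨h1, -, h3, -⟩ := hball t (hmem t (hIcc ht))
    obtain ⟨hVp, he, hk⟩ := h1 ht.1
    have hs : V t ^ (1 / q) ∈ Set.Ioo (0 : ℝ) 1 :=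
      ⟨Real.rpow_pos_of_pos hVp _, Real.rpow_lt_one hVp.le h3 hα⟩
    refine ⟨hs, ?_, hk⟩
    have hsq : (V t ^ (1 / q)) ^ q = V t := by
      rw [← Real.rpow_mul hVp.le, one_div_mul_cancel hq0.ne', Real.rpow_one]
    rw [hgF _ hs.1.le hs.2, hsq, he, hk]
  have hXd : ∀ t ∈ Set.Ioc 0 δ, HasDerivAt X (1 / q * (t ^ (1 / q - 1) * h t)) t := by
    intro t ht
    have hk := (hball t (hmem t (hIcc ht))).2.2.2.1.differentiableAt.hasDerivAt
    have := (Real.hasDerivAt_rpow_const (p := 1 / q) (Or.inl ht.1.ne')).mul hk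
    refine this.congr_deriv ?_
    simp only [hh]
    rw [Real.rpow_sub_one ht.1.ne']
    have := ht.1.ne'
    field_simp
  have hXc : ContinuousOn X (Set.Icc 0 δ) := fun t ht =>
    ((Real.continuousAt_rpow_const t (1 / q) (Or.inr hα.le)).mul
      (hball t (hmem t ht)).2.2.2.1.continuousAt).continuousWithinAt
  have hXpos : ∀ t ∈ Set.Ioc 0 δ, 0 < 1 / q * (t ^ (1 / q - 1) * h t) := fun t ht =>
    mul_pos hα (mul_pos (Real.rpow_pos_of_pos ht.1 _) (hball t (hmem t (hIcc ht))).2.1)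
  have hXmono : StrictMonoOn X (Set.Icc 0 δ) := by
    refine strictMonoOn_of_deriv_pos (convex_Icc 0 δ) hXc fun t ht => ?_
    rw [interior_Icc] at ht
    have ht' : t ∈ Set.Ioc 0 δ := ⟨ht.1, ht.2.le⟩
    rw [(hXd t ht').deriv]
    exact hXpos t ht'
  have himg : X '' Set.Ioc 0 δ = Set.Ioc 0 (X δ) := by
    ext y
    constructor
    · rintro ⟨t, ht, rfl⟩
      refine ⟨?_, hXmono.monotoneOn (hIcc ht) (Set.right_mem_Icc.2 hδ.le) ht.2⟩
      rw [← hX0]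
      exact hXmono (Set.left_mem_Icc.2 hδ.le) (hIcc ht) ht.1
    · intro hy
      obtain ⟨t, ht, rfl⟩ := intermediate_value_Icc hδ.le hXc ⟨by rw [hX0]; exact hy.1.le, hy.2⟩
      refine ⟨t, ⟨lt_of_le_of_ne ht.1 ?_, ht.2⟩, rfl⟩
      rintro rfl
      rw [hX0] at hy
      exact lt_irrefl _ hy.1
  obtain ⟨hs, hF, hsX⟩ := hXF δ ⟨hδ, le_rfl⟩
  -- This s₀ is the s with phase δ: F(s₀) = X(δ) = s₀ e^δ > s₀.
  refine ⟨V δ ^ (1 / q), hs, ?_, fun m => ?_⟩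
  · rw [hF, ← hsX]
    exact lt_mul_of_one_lt_right hs.1 (Real.one_lt_exp_iff.2 hδ)
  rw [hF, ← himg, integral_image_eq_integral_abs_deriv_smul measurableSet_Ioc
    (fun t ht => (hXd t ht).hasDerivWithinAt)
    (hXmono.injOn.mono Set.Ioc_subset_Icc_self), ← integral_const_mul]
  refine setIntegral_congr_fun measurableSet_Ioc fun t ht => ?_
  obtain ⟨hs, hF, hsX⟩ := hXF t ht
  have hsin : |sinPQ p q (X t) / X t| = Real.exp (-t) := by
    rw [← hF, sinPQ_arcsinPQ hp hq ⟨hs.1.le, hs.2.le⟩, hF, ← hsX, Real.exp_neg,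
      div_mul_cancel_left₀ hs.1.ne', abs_of_pos (by positivity)]
  simp only [smul_eq_mul]
  rw [hsin, abs_of_pos (hXpos t ht), ← Real.exp_mul, neg_mul_comm, mul_comm t]
  ring_nf

/-- The part of the integral away from `0` is smaller than every power of `m`. -/
theorem isBigO_integral_sinPQ_tail {p q : ℝ} (hp : 1 < p) (hq : 1 < q) {s₀ : ℝ}
    (hs₀ : s₀ ∈ Set.Ioo (0 : ℝ) 1) (hs₀' : s₀ < arcsinPQ p q s₀) (r : ℝ) (N : ℕ) :
    (fun m : ℝ => m ^ r * ∫ x in Set.Ioi (arcsinPQ p q s₀), |sinPQ p q x / x| ^ m)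
      =O[atTop] fun m : ℝ => 1 / m ^ N := by
  set ρ := 1 / (1 + (arcsinPQ p q s₀ - s₀)) with hρ
  have hρ0 : 0 < ρ := by rw [hρ]; exact one_div_pos.2 (by linarith)
  have hρ1 : ρ < 1 := by
    rw [hρ, div_lt_one (by linarith)]; linarith
  have hx₀ : 0 < arcsinPQ p q s₀ := hs₀.1.trans hs₀'
  have hI : ∀ m : ℝ, 1 < m →
      IntegrableOn (fun x : ℝ => |sinPQ p q x / x| ^ m) (Set.Ioi (arcsinPQ p q s₀)) :=
    fun m hm => (integrableOn_abs_sinPQ_div_rpow hp hq hm).mono_set (Set.Ioi_subset_Ioi hx₀.le)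
  -- Two powers are kept for integrability; the other m - 2 supply the factor ρ^(m-2).
  set J := ∫ x in Set.Ioi (arcsinPQ p q s₀), |sinPQ p q x / x| ^ (2 : ℝ) with hJ
  have hbound : ∀ m : ℝ, 2 ≤ m →
      ∫ x in Set.Ioi (arcsinPQ p q s₀), |sinPQ p q x / x| ^ m ≤ ρ ^ (m - 2) * J := by
    intro m hm
    rw [hJ, ← integral_const_mul]
    refine setIntegral_mono_on (hI m (by linarith)) ((hI 2 one_lt_two).const_mul _)
      measurableSet_Ioi fun x hx => ?_
    have hb := abs_sinPQ_div_le hp hq ⟨hs₀.1.le, hs₀.2.le⟩ (hx₀.trans hx) (le_of_lt hx)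
    calc |sinPQ p q x / x| ^ m
        = |sinPQ p q x / x| ^ (m - 2) * |sinPQ p q x / x| ^ (2 : ℝ) := by
          rw [← Real.rpow_add' (abs_nonneg _) (by linarith)]; ring_nf
      _ ≤ _ := mul_le_mul_of_nonneg_right
          (Real.rpow_le_rpow (abs_nonneg _) hb (by linarith)) (by positivity)
  have hlog : 0 < -Real.log ρ := neg_pos.2 (Real.log_neg hρ0 hρ1)
  have h1 : (fun m : ℝ => m ^ r * ∫ x in Set.Ioi (arcsinPQ p q s₀), |sinPQ p q x / x| ^ m)
      =O[atTop] fun m : ℝ => m ^ r * Real.exp (-(-Real.log ρ) * m) := by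
    refine IsBigO.of_bound (ρ ^ (-2 : ℝ) * J) ?_
    filter_upwards [eventually_ge_atTop 2] with m hm
    have hm0 : 0 < m := by linarith
    have h0 : 0 ≤ ∫ x in Set.Ioi (arcsinPQ p q s₀), |sinPQ p q x / x| ^ m :=
      integral_nonneg fun x => by positivity
    rw [Real.norm_of_nonneg (by positivity), Real.norm_of_nonneg (by positivity), neg_neg,
      ← Real.rpow_def_of_pos hρ0]
    calc _ ≤ m ^ r * (ρ ^ (m - 2) * J) :=
          mul_le_mul_of_nonneg_left (hbound m hm) (by positivity)
      _ = _ := by rw [sub_eq_add_neg, Real.rpow_add hρ0]; ring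
  refine h1.trans ?_
  have h2 := (isLittleO_exp_neg_mul_rpow_atTop hlog (-N - r)).isBigO
  have h3 := (isBigO_refl (fun m : ℝ => m ^ r) atTop).mul h2
  refine h3.trans_eventuallyEq ?_
  filter_upwards [eventually_gt_atTop 0] with m hm
  rw [← Real.rpow_add hm, add_sub_cancel, Real.rpow_neg hm.le, Real.rpow_natCast, one_div]

/-! ### Assembly of the expansion and its first two terms -/

theorem mainTheorem3 (p q : ℝ) (hp : 1 < p) (hq : 1 < q) :
    (∀ m : ℝ, 1 < m →
      IntegrableOn (fun x : ℝ => |sinPQ p q x / x| ^ m) (Set.Ioi 0) volume) ∧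
    ∃ γ : ℕ → ℝ,
      HasAsymptoticExpansionAtTop (sincIntegralPQ p q)
        (fun j : ℕ => 1 / q * (Real.Gamma (j + 1 / q) * γ j)) ∧
      1 / q * (Real.Gamma (1 / q) * γ 0) =
        1 / q * Real.Gamma (1 / q) * (p * (q + 1)) ^ (1 / q) ∧
      1 / q * (Real.Gamma (1 + 1 / q) * γ 1) =
        -(1 / q * Real.Gamma (1 / q) * (p * (q + 1)) ^ (1 / q) *
          ((q + 1) * (p * q ^ 2 + 2 * p * q - 3 * q ^ 2 + p - 2 * q) /
            (2 * q ^ 2 * (2 * q + 1)))) := by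
  refine ⟨fun m hm => integrableOn_abs_sinPQ_div_rpow hp hq hm, ?_⟩
  have hq0 : 0 < q := by linarith
  have hα : 0 < 1 / q := by positivity
  obtain ⟨h, ⟨P, hP⟩, hh0, hh1, δ₁, hδ₁, hsub⟩ := exists_analyticAt_integral_sinPQ hp hq
  obtain ⟨δ₀, hδ₀, htaylor⟩ := hP.exists_indicator_taylor_bound
  -- Below δ₀ the cut-off h satisfies global Taylor bounds; below δ₁ the substitution is valid.
  obtain ⟨δ, hδ, hδlt⟩ := exists_between (lt_min hδ₀ hδ₁)
  obtain ⟨hcont, s₀, hs₀, hs₀F, hint⟩ := hsub δ hδ (hδlt.trans_le (min_le_right _ _))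
  have hb := htaylor δ hδ (hδlt.trans_le (min_le_left _ _))
  refine ⟨P.coeff, fun N => ?_, ?_, ?_⟩
  · have hmeas : AEStronglyMeasurable ((Set.Ioc 0 δ).indicator h)
        (volume.restrict (Set.Ioi 0)) := by
      refine AEStronglyMeasurable.mono_measure ?_ Measure.restrict_le_self
      exact (aestronglyMeasurable_indicator_iff measurableSet_Ioc).2
        (hcont.aestronglyMeasurable measurableSet_Ioc)
    obtain ⟨C, hC⟩ := watson_lemma hα hmeas hb N
    have hnear : (fun m : ℝ => m ^ (1 / q) *
        (∫ x in Set.Ioc 0 (arcsinPQ p q s₀), |sinPQ p q x / x| ^ m) -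
          ∑ j ∈ Finset.range N, 1 / q * (Real.Gamma (j + 1 / q) * P.coeff j) / m ^ j)
        =O[atTop] fun m : ℝ => 1 / m ^ N := by
      refine IsBigO.of_bound (1 / q * C) ?_
      filter_upwards [eventually_gt_atTop 0] with m hm
      have hind : ∫ t in Set.Ioc 0 δ, Real.exp (-m * t) * t ^ (1 / q - 1) * h t =
          ∫ t in Set.Ioi (0 : ℝ),
            Real.exp (-m * t) * t ^ (1 / q - 1) * (Set.Ioc 0 δ).indicator h t := by
        rw [← integral_indicator measurableSet_Ioc, ← integral_indicator measurableSet_Ioi]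
        congr 1
        ext t
        by_cases ht : t ∈ Set.Ioc 0 δ
        · have ht0 : t ∈ Set.Ioi (0 : ℝ) := ht.1
          simp only [Set.indicator_of_mem ht, Set.indicator_of_mem ht0]
        · rw [Set.indicator_of_notMem ht, eq_comm, Set.indicator_apply_eq_zero]
          intro _
          rw [Set.indicator_of_notMem ht, mul_zero]
      have heq : m ^ (1 / q) *
          (∫ x in Set.Ioc 0 (arcsinPQ p q s₀), |sinPQ p q x / x| ^ m) -
          ∑ j ∈ Finset.range N, 1 / q * (Real.Gamma (j + 1 / q) * P.coeff j) / m ^ j =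
          1 / q * (m ^ (1 / q) * (∫ t in Set.Ioi (0 : ℝ),
            Real.exp (-m * t) * t ^ (1 / q - 1) * (Set.Ioc 0 δ).indicator h t) -
            ∑ j ∈ Finset.range N, Real.Gamma (j + 1 / q) * P.coeff j / m ^ j) := by
        rw [hint, hind, mul_sub, Finset.mul_sum]
        congr 1
        · ring
        · exact Finset.sum_congr rfl fun j _ => by ring
      rw [heq, norm_mul, Real.norm_of_nonneg hα.le, Real.norm_eq_abs,
        Real.norm_of_nonneg (by positivity), mul_assoc]
      refine mul_le_mul_of_nonneg_left ((hC m hm).trans (le_of_eq ?_)) hα.le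
      ring
    refine (hnear.add (isBigO_integral_sinPQ_tail hp hq hs₀ hs₀F (1 / q) N)).congr' ?_
      EventuallyEq.rfl
    filter_upwards [eventually_gt_atTop 1] with m hm
    have hI := integrableOn_abs_sinPQ_div_rpow hp hq hm
    have hx₀ : 0 < arcsinPQ p q s₀ := hs₀.1.trans hs₀F
    rw [sincIntegralPQ, ← Set.Ioc_union_Ioi_eq_Ioi hx₀.le,
      setIntegral_union (Set.Ioc_disjoint_Ioi le_rfl) measurableSet_Ioi
        (hI.mono_set Set.Ioc_subset_Ioi_self) (hI.mono_set (Set.Ioi_subset_Ioi hx₀.le))]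
    ring
  · have : P.coeff 0 = h 0 := hP.coeff_zero 1
    rw [this, hh0]
    ring
  · have : P.coeff 1 = deriv h 0 := hP.deriv.symm
    -- Γ(1 + 1/q) = Γ(1/q)/q brings out the common factor Γ(1/q).
    rw [this, hh1, add_comm 1, Real.Gamma_add_one hα.ne']
    field_simp
    ring
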